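/- Let $A$ be a (complex, not necessarily unital) C$^*$-algebra. A Banach $A$-bimodule is a complex Banach space $X$ with bounded bilinear left and right actions of $A$ that are associative and satisfy $a(xb)=(ax)b$; it is essential if the linear spans of $AX=\{ax : a\in A,\ x\in X\}$ and of $XA=\{xa : a\in A,\ x\in X\}$ are both dense in $X$. The dual $X^*$ is a Banach $A$-bimodule with $(af)(x)=f(xa)$ and $(fa)(x)=f(ax)$. Let $X$ be an essential Banach $A$-bimodule, and let $Y$ be either an essential Banach $A$-bimodule or the dual of an essential Banach $A$-bimodule. Then a bounded linear operator $D\colon X\to Y$ is hyperlocal, that is, $$ax=xb=0 \ \text{ implies } \ aD(x)b=0 \qquad (a,b\in A,\ x\in X),$$ if and only if $$D(axb)-aD(xb)-D(ax)b+aD(x)b=0 \qquad\text{for all } a,b\in A,\ x\in X.$$ -/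

import Mathlib

/-- A Banach space `X` in `A`-mod-`B`: a left `A`-module and a right `B`-module with
`a (x b) = (a x) b`, both actions being bounded bilinear maps.  Here `left a x` is `a x` and
`right b x` is `x b`.  Neither algebra is assumed to be unital. -/
structure BanachBimodule (A B X : Type*)
    [NonUnitalNormedRing A] [NormedSpace ℂ A] [NonUnitalNormedRing B] [NormedSpace ℂ B]
    [NormedAddCommGroup X] [NormedSpace ℂ X] [CompleteSpace X] where
  /-- the left action `a x` -/
  left : A →L[ℂ] X →L[ℂ] X
  /-- the right action `x b` -/
  right : B →L[ℂ] X →L[ℂ] X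
  left_mul : ∀ (a a' : A) (x : X), left (a * a') x = left a (left a' x)
  right_mul : ∀ (b b' : B) (x : X), right (b * b') x = right b' (right b x)
  left_right : ∀ (a : A) (b : B) (x : X), left a (right b x) = right b (left a x)

namespace BanachBimodule

/-- `X` is essential: the linear span of `A X` and the linear span of `X B` are both dense
in `X`. -/
def IsEssential {A B X : Type*}
    [NonUnitalNormedRing A] [NormedSpace ℂ A] [NonUnitalNormedRing B] [NormedSpace ℂ B]
    [NormedAddCommGroup X] [NormedSpace ℂ X] [CompleteSpace X]
    (M : BanachBimodule A B X) : Prop :=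
  Dense (Submodule.span ℂ {z : X | ∃ (a : A) (x : X), z = M.left a x} : Set X) ∧
    Dense (Submodule.span ℂ {z : X | ∃ (b : B) (x : X), z = M.right b x} : Set X)

/-- The dual of `X` in `A`-mod-`B` is the Banach space `X*` in `B`-mod-`A` with the actions
`(b f) x = f (x b)` and `(f a) x = f (a x)`. -/
noncomputable def dual {A B X : Type*}
    [NonUnitalNormedRing A] [NormedSpace ℂ A] [NonUnitalNormedRing B] [NormedSpace ℂ B]
    [NormedAddCommGroup X] [NormedSpace ℂ X] [CompleteSpace X]
    (M : BanachBimodule A B X) : BanachBimodule B A (StrongDual ℂ X) where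
  left := (ContinuousLinearMap.compL ℂ X X ℂ).flip ∘L M.right
  right := (ContinuousLinearMap.compL ℂ X X ℂ).flip ∘L M.left
  left_mul b b' f := by ext x; simp [M.right_mul]
  right_mul a a' f := by ext x; simp [M.left_mul]
  left_right b a f := by ext x; simp [M.left_right]

theorem dual_left_apply {A B X : Type*}
    [NonUnitalNormedRing A] [NormedSpace ℂ A] [NonUnitalNormedRing B] [NormedSpace ℂ B]
    [NormedAddCommGroup X] [NormedSpace ℂ X] [CompleteSpace X]
    (M : BanachBimodule A B X) (b : B) (f : StrongDual ℂ X) (x : X) :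
    M.dual.left b f x = f (M.right b x) := rfl

theorem dual_right_apply {A B X : Type*}
    [NonUnitalNormedRing A] [NormedSpace ℂ A] [NonUnitalNormedRing B] [NormedSpace ℂ B]
    [NormedAddCommGroup X] [NormedSpace ℂ X] [CompleteSpace X]
    (M : BanachBimodule A B X) (a : A) (f : StrongDual ℂ X) (x : X) :
    M.dual.right a f x = f (M.left a x) := rfl

end BanachBimodule

/-- An operator `D : X → Y` between spaces in `A`-mod-`B` is hyperlocal if `a x = 0 = x b`
implies `a D(x) b = 0`. -/
def IsHyperlocal {A B X Y : Type*}
    [NonUnitalNormedRing A] [NormedSpace ℂ A] [NonUnitalNormedRing B] [NormedSpace ℂ B]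
    [NormedAddCommGroup X] [NormedSpace ℂ X] [CompleteSpace X]
    [NormedAddCommGroup Y] [NormedSpace ℂ Y] [CompleteSpace Y]
    (M : BanachBimodule A B X) (N : BanachBimodule A B Y) (D : X →L[ℂ] Y) : Prop :=
  ∀ (a : A) (b : B) (x : X), M.left a x = 0 → M.right b x = 0 → N.left a (N.right b (D x)) = 0

/-! The engine is that a bounded bilinear map on a C⋆-algebra vanishing whenever `u * v = 0` is
balanced, `φ (a * b) c = φ a (b * c)` (`map_mul_eq_of_zero_product`). Through the unitization this
becomes `G c 1 = G 1 c`, where `c` may be taken self-adjoint. The defect is linear in `c`, yet at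
most `2 * ‖G‖` whatever the size of `c` (`norm_sub_le_of_zero_product`), so rescaling `c` kills it.

Hyperlocality feeds this engine twice. If `b' b = 0`, then `(u, v) ↦ u D(v x b') b` vanishes on zero
products, hence is balanced. The resulting difference, as a function of `(b', b)`, again vanishes on
zero products, hence is balanced too. Together this says `a E(a' x b') b = 0`, with `E x = D(c x e)
- c D(x e) - D(c x) e + c D(x) e`. Essentiality then removes the four outer factors. The converse is
substitution. -/

open Filter Topology

/-! ### Zero products in unital C⋆-algebras -/

/-- The ramp function, constant outside `[0, 1]` and the identity on it. -/
noncomputable def ramp (x : ℝ) : ℝ := max 0 (min x 1)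

theorem continuous_ramp : Continuous ramp := by
  unfold ramp; fun_prop

theorem monotone_ramp : Monotone ramp := fun _ _ h => by
  unfold ramp; gcongr

theorem ramp_nonneg (x : ℝ) : 0 ≤ ramp x := le_max_left _ _

theorem ramp_le_one (x : ℝ) : ramp x ≤ 1 := max_le zero_le_one (min_le_right _ _)

theorem ramp_of_nonpos {x : ℝ} (h : x ≤ 0) : ramp x = 0 :=
  max_eq_left ((min_le_left _ _).trans h)

theorem ramp_of_one_le {x : ℝ} (h : 1 ≤ x) : ramp x = 1 := by
  simp [ramp, min_eq_right h]

theorem sum_ramp_sub (x : ℝ) (m : ℕ) :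
    ∑ i ∈ Finset.range m, ramp (x - i) = max 0 (min x m) := by
  induction m with
  | zero => simp
  | succ m ih =>
    rw [Finset.sum_range_succ, ih, ramp]
    have : (0 : ℝ) ≤ m := m.cast_nonneg
    push_cast
    grind

/-- A diagonal sum of values of a bilinear map is bounded by the values of the map at
randomly signed sums. -/
theorem norm_add_sum_bilinear_le {U Z ι : Type*} [NormedAddCommGroup U] [NormedSpace ℂ U]
    [NormedAddCommGroup Z] [NormedSpace ℂ Z] [DecidableEq ι]
    (G : U →L[ℂ] U →L[ℂ] Z) (u v : ι → U) (K : ℝ) (s : Finset ι) :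
    ∀ u₀ v₀ : U, (∀ ε : ι → ℝ, (∀ i, |ε i| ≤ 1) →
        ‖G (u₀ + ∑ i ∈ s, ε i • u i) (v₀ + ∑ i ∈ s, ε i • v i)‖ ≤ K) →
      ‖G u₀ v₀ + ∑ i ∈ s, G (u i) (v i)‖ ≤ K := by
  induction s using Finset.induction_on with
  | empty => intro u₀ v₀ h; simpa using h 0 (by simp)
  | insert j s hj ih =>
    intro u₀ v₀ h
    -- The offsets `u₀`, `v₀` absorb the term `j`. Averaging over `δ = 1` and `δ = -1` cancels the
    -- cross terms and keeps `G (u j) (v j)`.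
    have key : ∀ δ : ℝ, |δ| ≤ 1 →
        ‖G (u₀ + δ • u j) (v₀ + δ • v j) + ∑ i ∈ s, G (u i) (v i)‖ ≤ K := by
      intro δ hδ
      refine ih _ _ fun ε hε => ?_
      have h' := h (Function.update ε j δ) fun i => by
        by_cases hi : i = j
        · subst hi; simpa using hδ
        · simpa [hi] using hε i
      have hs : ∀ w : ι → U, ∑ i ∈ s, Function.update ε j δ i • w i = ∑ i ∈ s, ε i • w i :=
        fun w => Finset.sum_congr rfl fun i hi => by
          rw [Function.update_of_ne (ne_of_mem_of_not_mem hi hj)]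
      simpa [Finset.sum_insert hj, hs, add_assoc] using h'
    have h₁ := key 1 (by simp)
    have h₂ := key (-1) (by simp)
    simp only [one_smul, neg_smul, map_add, map_neg, add_apply,
      neg_apply] at h₁ h₂
    rw [Finset.sum_insert hj]
    set S := ∑ i ∈ s, G (u i) (v i)
    have h₃ := norm_add_le_of_le h₁ h₂
    have h₄ : ‖(2 : ℂ) • (G u₀ v₀ + (G (u j) (v j) + S))‖ ≤ K + K := by
      refine le_of_eq_of_le (congrArg _ ?_) h₃
      module
    rw [norm_smul] at h₄
    norm_num at h₄
    linarith

section CStar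

variable {U Z : Type*} [CStarAlgebra U] [NormedAddCommGroup Z] [NormedSpace ℂ Z]

/-- On the spectrum the differences are nonnegative and telescope to at most `1`, so coefficients in
`[-1, 1]` keep the sum in the unit ball, however large `N` is. -/
theorem norm_sum_smul_ramp_sub_le (c : U) (y : ℝ) (N k : ℕ) (ε : ℕ → ℝ) (hε : ∀ i, |ε i| ≤ 1) :
    ‖∑ i ∈ Finset.range N, ε i • (cfc (fun t : ℝ => ramp (t + y - ((i + k : ℕ) : ℝ))) c -
      cfc (fun t : ℝ => ramp (t + y - ((i + k + 1 : ℕ) : ℝ))) c)‖ ≤ 1 := by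
  have hcont : ∀ z : ℝ, Continuous fun t : ℝ => ramp (t + y - z) := fun z =>
    continuous_ramp.comp (by fun_prop)
  have hsum : ∑ i ∈ Finset.range N, ε i •
      (cfc (fun t : ℝ => ramp (t + y - ((i + k : ℕ) : ℝ))) c -
        cfc (fun t : ℝ => ramp (t + y - ((i + k + 1 : ℕ) : ℝ))) c) =
      cfc (∑ i ∈ Finset.range N, fun t : ℝ => ε i • (ramp (t + y - ((i + k : ℕ) : ℝ)) -
        ramp (t + y - ((i + k + 1 : ℕ) : ℝ)))) c := by
    rw [cfc_sum (fun (i : ℕ) (t : ℝ) => ε i • (ramp (t + y - ((i + k : ℕ) : ℝ)) -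
        ramp (t + y - ((i + k + 1 : ℕ) : ℝ)))) c _ fun i _ =>
      (((hcont _).sub (hcont _)).const_smul (ε i)).continuousOn]
    refine Finset.sum_congr rfl fun i _ => ?_
    rw [cfc_smul (ε i) (fun t : ℝ => ramp (t + y - ((i + k : ℕ) : ℝ)) -
        ramp (t + y - ((i + k + 1 : ℕ) : ℝ))) c ((hcont _).sub (hcont _)).continuousOn,
      cfc_sub _ _ c (hcont _).continuousOn (hcont _).continuousOn]
  rw [hsum]
  refine norm_cfc_le zero_le_one fun t _ => ?_
  rw [Finset.sum_apply]
  calc _ ≤ ∑ i ∈ Finset.range N, (ramp (t + y - ((i + k : ℕ) : ℝ)) -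
        ramp (t + y - ((i + 1 + k : ℕ) : ℝ))) := by
        refine norm_sum_le_of_le _ fun i _ => ?_
        have h : 0 ≤ ramp (t + y - ((i + k : ℕ) : ℝ)) - ramp (t + y - ((i + k + 1 : ℕ) : ℝ)) :=
          sub_nonneg.2 (monotone_ramp (by push_cast; linarith))
        rw [norm_smul, Real.norm_of_nonneg h, add_right_comm i 1 k]
        exact mul_le_of_le_one_left h (hε i)
    _ ≤ 1 := by
        rw [Finset.sum_range_sub' fun i : ℕ => ramp (t + y - ((i + k : ℕ) : ℝ))]
        linarith [ramp_le_one (t + y - ((0 + k : ℕ) : ℝ)),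
          ramp_nonneg (t + y - ((N + k : ℕ) : ℝ))]

/-- The spectrum is cut into unit steps. Only neighbouring pieces contribute to the defect, and sign
averaging bounds their total independently of the number of pieces, hence of `‖c‖`. -/
theorem norm_sub_le_of_zero_product (G : U →L[ℂ] U →L[ℂ] Z)
    (hG : ∀ u v, u * v = 0 → G u v = 0) (c : U) (hc : IsSelfAdjoint c) :
    ‖G c 1 - G 1 c‖ ≤ 2 * ‖G‖ := by
  obtain ⟨n, hn⟩ := exists_nat_ge (‖c‖ * ‖(1 : U)‖)
  have hspec : ∀ t ∈ spectrum ℝ c, |t| ≤ n := fun t ht =>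
    (spectrum.norm_le_norm_mul_of_mem ht).trans hn
  have hcont : ∀ z : ℝ, Continuous fun t : ℝ => ramp (t + (n + 1) - z) := fun z =>
    continuous_ramp.comp (by fun_prop)
  -- The spectrum lies in `[-n, n]`, so the shift `n + 1` makes `r 0 = 1` and makes `r 1, …, r (2 *
  -- n)` add up to `c + n`.
  set r : ℕ → U := fun i => cfc (fun t : ℝ => ramp (t + (n + 1) - (i : ℝ))) c with hr
  set p : ℕ → U := fun i => r i - r (i + 1) with hp
  have hmul : ∀ i j, i < j → r j * (1 - r i) = 0 := by
    intro i j hij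
    have hij' : (i : ℝ) + 1 ≤ j := by exact_mod_cast hij
    rw [← cfc_const_one ℝ c, ← cfc_sub _ _ c continuousOn_const (hcont _).continuousOn,
      ← cfc_mul _ (fun t : ℝ => 1 - ramp (t + (n + 1) - i)) c (hcont _).continuousOn
        (continuous_const.sub (hcont _)).continuousOn, ← cfc_const_zero ℝ c]
    congr 1
    ext t
    rcases le_total (t + (n + 1) - (j : ℝ)) 0 with h | h
    · rw [ramp_of_nonpos h, zero_mul]
    · rw [ramp_of_one_le (x := t + (n + 1) - (i : ℝ)) (by linarith), sub_self, mul_zero]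
  have hmul' : ∀ i j, i < j → (1 - r i) * r j = 0 := fun i j hij => by
    have : Commute (r j) (r i) := cfc_commute_cfc _ _ _
    rw [← hmul i j hij, sub_mul, mul_sub, one_mul, mul_one, this.eq]
  -- For `i < j`, `r j` is orthogonal to `1 - r i`, so in either slot `G` cannot distinguish `r i`
  -- from `1` against `r j`.
  have h₁ : ∀ i, G (r (i + 1)) 1 - G 1 (r (i + 1)) = G (p (i + 1)) (p i) - G (p i) (p (i + 1)) := by
    intro i
    have e₁ := hG _ _ (hmul i (i + 1) (by lia))
    have e₂ := hG _ _ (hmul' i (i + 1) (by lia))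
    have e₃ := hG _ _ (hmul (i + 1) (i + 1 + 1) (by lia))
    have e₄ := hG _ _ (hmul' (i + 1) (i + 1 + 1) (by lia))
    have e₅ := hG _ _ (hmul i (i + 1 + 1) (by lia))
    have e₆ := hG _ _ (hmul' i (i + 1 + 1) (by lia))
    simp only [hp, map_sub, sub_apply] at e₁ e₂ e₃ e₄ e₅ e₆ ⊢
    linear_combination (norm := module) e₁ - e₂ + e₃ - e₄ - e₅ + e₆
  have hone : r 0 = 1 := by
    rw [← cfc_const_one ℝ c]
    refine cfc_congr fun t ht => ramp_of_one_le ?_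
    have := abs_le.1 (hspec t ht)
    push_cast
    linarith
  have hsum : ∑ i ∈ Finset.range (2 * n), r (i + 1) = c + (n : ℝ) • (1 : U) := by
    have : c + (n : ℝ) • (1 : U) = cfc (fun t : ℝ => t + n) c := by
      rw [cfc_add_const _ (fun t : ℝ => t) c, cfc_id' ℝ c, Algebra.algebraMap_eq_smul_one]
    rw [this, hr, ← cfc_sum (fun i : ℕ => fun t : ℝ => ramp (t + (n + 1) - ((i + 1 : ℕ) : ℝ))) c _
      fun i _ => (hcont _).continuousOn]
    refine cfc_congr fun t ht => ?_
    have h := abs_le.1 (hspec t ht)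
    have h' := sum_ramp_sub (t + n) (2 * n)
    rw [min_eq_left (by push_cast; linarith), max_eq_right (by linarith)] at h'
    rw [Finset.sum_apply, ← h']
    refine Finset.sum_congr rfl fun i _ => ?_
    congr 1
    push_cast
    ring
  have hdiff : G c 1 - G 1 c = ∑ i ∈ Finset.range (2 * n), G (p (i + 1)) (p i) -
      ∑ i ∈ Finset.range (2 * n), G (p i) (p (i + 1)) := by
    rw [← Finset.sum_sub_distrib, ← Finset.sum_congr rfl fun i _ => h₁ i, Finset.sum_sub_distrib,
      ← map_sum, ← sum_apply, ← map_sum, hsum, map_add, map_add,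
      add_apply, ← Complex.coe_smul, map_smul, map_smul,
      smul_apply]
    abel
  have hbound : ∀ k l : ℕ, ‖∑ i ∈ Finset.range (2 * n), G (p (i + k)) (p (i + l))‖ ≤ ‖G‖ := by
    intro k l
    have := norm_add_sum_bilinear_le G (fun i => p (i + k)) (fun i => p (i + l)) ‖G‖
      (Finset.range (2 * n)) 0 0 fun ε hε => ?_
    · simpa using this
    · rw [zero_add, zero_add]
      refine (G.le_opNorm₂ _ _).trans ?_
      rw [mul_assoc]
      exact mul_le_of_le_one_right G.opNorm_nonneg
        (mul_le_one₀ (norm_sum_smul_ramp_sub_le c (n + 1) _ k ε hε) (norm_nonneg _)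
          (norm_sum_smul_ramp_sub_le c (n + 1) _ l ε hε))
  rw [hdiff, two_mul ‖G‖]
  exact norm_sub_le_of_le (hbound 1 0) (hbound 0 1)

/-- A bounded bilinear map on a unital C⋆-algebra that vanishes on zero products is symmetric
against the unit. -/
theorem apply_one_eq_of_zero_product (G : U →L[ℂ] U →L[ℂ] Z)
    (hG : ∀ u v, u * v = 0 → G u v = 0) (b : U) : G b 1 = G 1 b := by
  have hsa : ∀ c : U, IsSelfAdjoint c → G c 1 = G 1 c := by
    intro c hc
    rw [← sub_eq_zero, ← norm_eq_zero]
    refine le_antisymm (le_of_forall_pos_le_add fun δ hδ => ?_) (norm_nonneg _)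
    obtain ⟨m, hm⟩ := exists_nat_gt (2 * ‖G‖ / δ)
    have hm' := (div_lt_iff₀ hδ).1 hm
    have h := norm_sub_le_of_zero_product G hG ((m : ℝ) • c) ((IsSelfAdjoint.all (m : ℝ)).smul hc)
    have hm0 : (0 : ℝ) < m := (by positivity : 0 ≤ 2 * ‖G‖ / δ).trans_lt hm
    rw [← Complex.coe_smul, map_smul, map_smul, smul_apply, ← smul_sub, norm_smul,
      Complex.norm_real, Real.norm_of_nonneg hm0.le] at h
    rw [zero_add]
    exact le_of_mul_le_mul_left (h.trans hm'.le) hm0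
  rw [← realPart_add_I_smul_imaginaryPart b]
  simp only [map_add, map_smul, add_apply, smul_apply]
  rw [hsa _ (realPart b).2, hsa _ (imaginaryPart b).2]

end CStar

/-! ### Balanced maps and faithfulness without a unit -/

section NonUnital

variable {A Z : Type*} [NonUnitalCStarAlgebra A] [NormedAddCommGroup Z] [NormedSpace ℂ Z]

/-- The second coordinate of the unitization, as a continuous linear map. -/
noncomputable def unitizationSnd (A : Type*) [NonUnitalCStarAlgebra A] :
    Unitization ℂ A →L[ℂ] A :=
  ⟨Unitization.sndHom ℂ ℂ A, Unitization.uniformContinuous_snd.continuous⟩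

@[simp]
theorem unitizationSnd_apply (u : Unitization ℂ A) : unitizationSnd A u = u.snd := rfl

/-- A bounded bilinear map on a C⋆-algebra that vanishes on zero products is balanced. -/
theorem map_mul_eq_of_zero_product (φ : A →L[ℂ] A →L[ℂ] Z)
    (hφ : ∀ a b, a * b = 0 → φ a b = 0) (a b c : A) : φ (a * b) c = φ a (b * c) := by
  -- Since `A` is an ideal of its unitization, `G u v = φ (a u) (v c)` makes sense there, and `u v =
  -- 0` forces `(a u)(v c) = 0`.
  let L : Unitization ℂ A →L[ℂ] A :=
    unitizationSnd A ∘L ContinuousLinearMap.mul ℂ (Unitization ℂ A) (a : Unitization ℂ A)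
  let R : Unitization ℂ A →L[ℂ] A :=
    unitizationSnd A ∘L (ContinuousLinearMap.mul ℂ (Unitization ℂ A)).flip (c : Unitization ℂ A)
  have hL : ∀ u : Unitization ℂ A, ((L u : A) : Unitization ℂ A) = a * u := fun u => by
    ext <;> simp [L]
  have hR : ∀ u : Unitization ℂ A, ((R u : A) : Unitization ℂ A) = u * c := fun u => by
    ext <;> simp [R]
  have h := apply_one_eq_of_zero_product (φ.bilinearComp L R) (fun u v huv => by
    refine hφ _ _ (Unitization.inr_injective (R := ℂ) ?_)
    change ((L u * R v : A) : Unitization ℂ A) = ((0 : A) : Unitization ℂ A)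
    rw [Unitization.inr_mul, hL, hR, mul_assoc, ← mul_assoc u, huv, zero_mul, mul_zero,
      Unitization.inr_zero]) (b : Unitization ℂ A)
  have hLb : L b = a * b := Unitization.inr_injective (R := ℂ) (by rw [hL, Unitization.inr_mul])
  have hRb : R b = b * c := Unitization.inr_injective (R := ℂ) (by rw [hR, Unitization.inr_mul])
  have hL1 : L 1 = a := Unitization.inr_injective (R := ℂ) (by rw [hL, mul_one])
  have hR1 : R 1 = c := Unitization.inr_injective (R := ℂ) (by rw [hR, one_mul])
  simpa [hLb, hRb, hL1, hR1] using h

/-- If a bounded action on `Y` tends strongly to the identity on `A Y` along a filter that is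
eventually in the unit ball, and the span of `A Y` is dense, then no nonzero vector is
annihilated by `A`. -/
theorem eq_zero_of_forall_apply_eq_zero_of_dense {Y : Type*} [NormedAddCommGroup Y] [NormedSpace ℂ Y]
    (T : A →L[ℂ] Y →L[ℂ] Y) {l : Filter A} [l.NeBot] (hl : ∀ᶠ e in l, ‖e‖ ≤ 1)
    (hT : ∀ (a : A) (y : Y), Tendsto (fun e => T e (T a y)) l (𝓝 (T a y)))
    (hd : Dense (Submodule.span ℂ {z : Y | ∃ (a : A) (y : Y), z = T a y} : Set Y))
    (y : Y) (hy : ∀ a, T a y = 0) : y = 0 := by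
  have hspan : ∀ z ∈ Submodule.span ℂ {z : Y | ∃ (a : A) (y : Y), z = T a y},
      Tendsto (fun e => T e z) l (𝓝 z) := by
    intro z hz
    induction hz using Submodule.span_induction with
    | mem z hz => obtain ⟨a, y, rfl⟩ := hz; exact hT a y
    | zero => simp
    | add u v _ _ hu hv => simpa using hu.add hv
    | smul k u _ hu => simpa using hu.const_smul k
  -- Since `T e y = 0`, `T e z = T e (z - y)`; let `e` run along `l`. By density the bound extends
  -- to `z = y`, where its right side is `0`.
  have hbound : ∀ z ∈ Submodule.span ℂ {z : Y | ∃ (a : A) (y : Y), z = T a y},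
      ‖z‖ ≤ ‖T‖ * ‖z - y‖ := by
    intro z hz
    refine le_of_tendsto (hspan z hz).norm (hl.mono fun e he => ?_)
    rw [← sub_zero (T e z), ← hy e, ← map_sub]
    refine (T.le_opNorm₂ _ _).trans ?_
    gcongr
    exact mul_le_of_le_one_right T.opNorm_nonneg he
  have hclosed : IsClosed {z : Y | ‖z‖ ≤ ‖T‖ * ‖z - y‖} :=
    isClosed_le (by fun_prop) (by fun_prop)
  have := (hclosed.closure_subset_iff.2 hbound) (hd y)
  simpa using this

end NonUnital

/-! ### Cancelling outer factors in essential bimodules and their duals -/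

namespace BanachBimodule

section

variable {A B X Z : Type*}
  [NonUnitalNormedRing A] [NormedSpace ℂ A] [NonUnitalNormedRing B] [NormedSpace ℂ B]
  [NormedAddCommGroup X] [NormedSpace ℂ X] [CompleteSpace X]
  [NormedAddCommGroup Z] [NormedSpace ℂ Z]

/-- An operator on an essential bimodule is determined by its values on the elements `a x b`. -/
theorem IsEssential.eq_zero_of_apply_left_right {M : BanachBimodule A B X} (hM : M.IsEssential)
    (E : X →L[ℂ] Z) (hE : ∀ a b x, E (M.left a (M.right b x)) = 0) : E = 0 := by
  have h₁ : ∀ a, E ∘L M.left a = 0 := fun a =>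
    ContinuousLinearMap.ext_on hM.2 (by rintro _ ⟨b, x, rfl⟩; exact hE a b x)
  exact ContinuousLinearMap.ext_on hM.1
    (by rintro _ ⟨a, x, rfl⟩; exact DFunLike.congr_fun (h₁ a) x)

end

section

variable {A Y : Type*} [NonUnitalCStarAlgebra A]
  [NormedAddCommGroup Y] [NormedSpace ℂ Y] [CompleteSpace Y]

/-- A contractive approximate unit of `A` acts as one on each side, so the factors can be cancelled
one at a time. -/
theorem IsEssential.eq_zero_of_left_right_eq_zero {N : BanachBimodule A A Y}
    (hN : N.IsEssential) (y : Y) (hy : ∀ a b, N.left a (N.right b y) = 0) : y = 0 := by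
  let := CStarAlgebra.spectralOrder A
  have := CStarAlgebra.spectralOrderedRing A
  have hu := CStarAlgebra.increasingApproximateUnit A
  have := hu.neBot
  have hleft : ∀ y, (∀ a, N.left a y = 0) → y = 0 :=
    eq_zero_of_forall_apply_eq_zero_of_dense N.left hu.eventually_norm (fun a y => by
      simp only [← N.left_mul]
      exact ((N.left.flip y).continuous.tendsto a).comp (hu.tendsto_mul_right a)) hN.1
  have hright : ∀ y, (∀ a, N.right a y = 0) → y = 0 :=
    eq_zero_of_forall_apply_eq_zero_of_dense N.right hu.eventually_norm (fun a y => by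
      simp only [← N.right_mul]
      exact ((N.right.flip y).continuous.tendsto a).comp (hu.tendsto_mul_left a)) hN.2
  exact hright y fun b => hleft _ fun a => hy a b

/-- The dual need not be essential; instead `f` vanishes on all products `a y b`, whose span is
dense. -/
theorem IsEssential.dual_eq_zero_of_left_right_eq_zero {N : BanachBimodule A A Y}
    (hN : N.IsEssential) (f : StrongDual ℂ Y)
    (hf : ∀ a b, N.dual.left a (N.dual.right b f) = 0) : f = 0 :=
  hN.eq_zero_of_apply_left_right f fun a b y => DFunLike.congr_fun (hf b a) y

end

end BanachBimodule

/-! ### Hyperlocal operators -/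

section Hyperlocal

variable {A X Y : Type*} [NonUnitalCStarAlgebra A]
  [NormedAddCommGroup X] [NormedSpace ℂ X] [CompleteSpace X]
  [NormedAddCommGroup Y] [NormedSpace ℂ Y] [CompleteSpace Y]
  {M : BanachBimodule A A X} {N : BanachBimodule A A Y} {D : X →L[ℂ] Y}

theorem IsHyperlocal.of_identity (h : ∀ (a b : A) (x : X),
    D (M.left a (M.right b x)) - N.left a (D (M.right b x))
      - N.right b (D (M.left a x)) + N.left a (N.right b (D x)) = 0) :
    IsHyperlocal M N D := fun a b x ha hb => by
  simpa [ha, hb] using h a b x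

/-- The right factors are frozen with `b' * b = 0`, so that `b` always annihilates `v x b'`;
hyperlocality then only needs `u * v = 0` on the left. -/
theorem IsHyperlocal.balanced_left (hD : IsHyperlocal M N D) {b b' : A} (hb : b' * b = 0)
    (a c a' : A) (x : X) :
    N.left (a * c) (N.right b (D (M.left a' (M.right b' x)))) =
      N.left a (N.right b (D (M.left (c * a') (M.right b' x)))) := by
  let φ : A →L[ℂ] A →L[ℂ] Y :=
    N.left.bilinearComp (.id ℂ A) (.id ℂ Y) |>.flip.comp
      (N.right b ∘L D ∘L M.left.flip (M.right b' x)) |>.flip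
  refine map_mul_eq_of_zero_product φ (fun u v huv => ?_) a c a'
  refine hD u b _ ?_ ?_
  · simp [← M.left_mul, huv]
  · change M.right b (M.left v (M.right b' x)) = 0
    rw [← M.left_right, ← M.right_mul, hb]
    simp

/-- The defect in `balanced_left` is itself bilinear in `(b', b)` and vanishes on zero products, so
`e` can be moved across. -/
theorem IsHyperlocal.balanced (hD : IsHyperlocal M N D) (a c a' b' e b : A) (x : X) :
    N.left (a * c) (N.right b (D (M.left a' (M.right (b' * e) x)))) -
        N.left a (N.right b (D (M.left (c * a') (M.right (b' * e) x)))) =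
      N.left (a * c) (N.right (e * b) (D (M.left a' (M.right b' x)))) -
        N.left a (N.right (e * b) (D (M.left (c * a') (M.right b' x)))) := by
  let ψ (a a' : A) : A →L[ℂ] A →L[ℂ] Y :=
    (ContinuousLinearMap.compL ℂ Y Y Y (N.left a) ∘L N.right).flip ∘L
      (D ∘L M.left a' ∘L M.right.flip x)
  exact map_mul_eq_of_zero_product (ψ (a * c) a' - ψ a (c * a'))
    (fun u v huv => sub_eq_zero.2 (hD.balanced_left huv a c a' x)) b' e b

theorem IsHyperlocal.identity (hM : M.IsEssential)
    (hN : ∀ y : Y, (∀ a b, N.left a (N.right b y) = 0) → y = 0)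
    (hD : IsHyperlocal M N D) (c e : A) (x : X) :
    D (M.left c (M.right e x)) - N.left c (D (M.right e x))
      - N.right e (D (M.left c x)) + N.left c (N.right e (D x)) = 0 := by
  let E : X →L[ℂ] Y := D ∘L M.left c ∘L M.right e - N.left c ∘L D ∘L M.right e -
    N.right e ∘L D ∘L M.left c + N.left c ∘L N.right e ∘L D
  suffices hE : E = 0 from DFunLike.congr_fun hE x
  refine hM.eq_zero_of_apply_left_right E fun a' b' y => hN _ fun a b => ?_
  -- Left side minus right side of `h` is `-a E(a' y b') b`.
  have h := hD.balanced a c a' b' e b y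
  simp only [N.left_mul, N.right_mul, M.left_mul, M.right_mul] at h
  simp only [E, add_apply, sub_apply,
    ContinuousLinearMap.comp_apply, map_add, map_sub, N.left_right, M.left_right] at h ⊢
  linear_combination (norm := module) -h

end Hyperlocal

theorem theoremT {A X Y : Type*} [NonUnitalCStarAlgebra A]
    [NormedAddCommGroup X] [NormedSpace ℂ X] [CompleteSpace X]
    [NormedAddCommGroup Y] [NormedSpace ℂ Y] [CompleteSpace Y]
    (M : BanachBimodule A A X) (hM : M.IsEssential)
    (N : BanachBimodule A A Y) (hN : N.IsEssential) :
    (∀ D : X →L[ℂ] Y, IsHyperlocal M N D ↔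
      ∀ (a b : A) (x : X),
        D (M.left a (M.right b x)) - N.left a (D (M.right b x))
          - N.right b (D (M.left a x)) + N.left a (N.right b (D x)) = 0) ∧
    (∀ D : X →L[ℂ] StrongDual ℂ Y, IsHyperlocal M N.dual D ↔
      ∀ (a b : A) (x : X),
        D (M.left a (M.right b x)) - N.dual.left a (D (M.right b x))
          - N.dual.right b (D (M.left a x)) + N.dual.left a (N.dual.right b (D x)) = 0) := by
  exact ⟨fun _ => ⟨fun hD a b x => hD.identity hM hN.eq_zero_of_left_right_eq_zero a b x,
      IsHyperlocal.of_identity⟩,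
    fun _ => ⟨fun hD a b x => hD.identity hM hN.dual_eq_zero_of_left_right_eq_zero a b x,
      IsHyperlocal.of_identity⟩⟩
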